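/- An ordered groupoid is a groupoid $G$ (a small category in which every morphism is invertible) with a partial order $\leqslant$ on its set of morphisms such that: (OG1) $x\leqslant y$ implies $x^{-1}\leqslant y^{-1}$; (OG2) if $x\leqslant y$, $u\leqslant v$ and the composites $xu$, $yv$ exist, then $xu\leqslant yv$; (OG3) if $e$ is an identity with $e\leqslant xx^{-1}$, there is a unique $(e|x)\leqslant x$ with source $e$; (OG4) if $e$ is an identity with $e\leqslant x^{-1}x$, there is a unique $(x|e)\leqslant x$ with target $e$. Here composites are written from left to right, and $g$ has source $gg^{-1}$ and target $g^{-1}g$. Let $E(G)$ be the poset of identities of $G$. The category $\mathfrak L(G)$ has the elements of $E(G)$ as objects; its morphisms $e\to f$ are the pairs $(e,g)$ with $g\in G$, $gg^{-1}\leqslant e$ and $g^{-1}g=f$; and $(e,g)(f,h)=(e,(g|hh^{-1})h)$. A $G$-module is a functor $\mathcal A$ from $\mathfrak L(G)$ to abelian groups, with value $A_e$ at $e$. For a small category $C$, let $H_n(C,-)$ $(n\geqslant 0)$ be the left derived functors of $\operatorname{colim}\colon \mathrm{Fun}(C,\mathbf{Ab})\to\mathbf{Ab}$, and put $H_n(G,-)=H_n(\mathfrak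 L(G),-)$. Write $g\,\beta\,h$ if there is $k\in G$ with $k\leqslant g$ and $k\leqslant h$, and call $G$ principally directed if $\beta$ is transitive (equivalently, if every set $\{g\in G: g\leqslant t\}$, $t\in G$, is downwards directed). In this case $G/\beta$ is a groupoid, whose objects are the $\beta$-classes of identities, with $(g\beta)(h\beta)=[(g|f)(f|h)]\beta$ for any identity $f$ below both $g^{-1}g$ and $hh^{-1}$. For a $G$-module $\mathcal A$, let $\operatorname{colim}^{E(G)}\mathcal A$ be the functor from $G/\beta$ to abelian groups whose value at a $\beta$-class $x$ of identities is $L_x=\operatorname{colim}_{e\in x}A_e$, the colimit being taken over the maps $A_e\to A_f$ given by $(e,f)$ for $e\geqslant f$ in $x$. A morphism $g\beta$ acts by sending the class of $a\in A_e$, where $e\,\beta\,gg^{-1}$, to the class of the image of $a$ under $(e,(\ell|g))$, for any identity $\ell$ below both $e$ and $gg^{-1}$. **Theorem.** Let $G$ be a principally directed ordered groupoid. Then for every $G$-module $\mathcal A$ and every $n\geqslant 0$, $$H_n(G,\mathcal A)\;\cong\; H_n\bigl(G/\beta,\ \operatorname{colim}^{E(G)}\mathcal A\bigr).$$ -/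

import Mathlib

open CategoryTheory CategoryTheory.Limits Opposite

universe u v

/-! ### Homology of a small category -/

/-- Functors from a small category to abelian groups have enough projectives: the free modules
on representable functors are projective and there are enough of them. -/
instance functorEnoughProjectives (C : Type u) [SmallCategory C] :
    EnoughProjectives (C ⥤ AddCommGrpCat.{u}) := by
  have : EnoughProjectives AddCommGrpCat.{u} :=
    ((forget₂ (ModuleCat.{u} ℤ) AddCommGrpCat.{u}).asEquivalence.enoughProjectives_iff).1
      inferInstance
  refine ⟨fun F => ?_⟩
  let P : C → (C ⥤ AddCommGrpCat.{u}) := fun c =>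
    (evaluationLeftAdjoint AddCommGrpCat.{u} c).obj (Projective.over (F.obj c))
  have : ∀ c, Projective (P c) := fun c =>
    (evaluationAdjunctionRight AddCommGrpCat.{u} c).map_projective _ inferInstance
  let t : ∀ c, P c ⟶ F := fun c =>
    ((evaluationAdjunctionRight AddCommGrpCat.{u} c).homEquiv _ _).symm
      (Projective.π (F.obj c))
  have ht : ∀ c, (evaluationAdjunctionRight AddCommGrpCat.{u} c).unit.app
      (Projective.over (F.obj c)) ≫ (t c).app c = Projective.π (F.obj c) := fun c => by
    have h := ((evaluationAdjunctionRight AddCommGrpCat.{u} c).homEquiv _ _).apply_symm_apply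
      (Projective.π (F.obj c))
    rw [Adjunction.homEquiv_unit] at h
    exact h
  suffices h : Epi (Sigma.desc t) from ⟨{ p := ∐ P, f := Sigma.desc t, epi := h }⟩
  rw [NatTrans.epi_iff_epi_app]
  intro c
  have h1 : (evaluationAdjunctionRight AddCommGrpCat.{u} c).unit.app
      (Projective.over (F.obj c)) ≫ (Sigma.ι P c ≫ Sigma.desc t).app c
      = Projective.π (F.obj c) := by
    rw [Sigma.ι_desc]
    exact ht c
  have h2 : Epi ((Sigma.ι P c ≫ Sigma.desc t).app c) := epi_of_epi_fac h1
  rw [NatTrans.comp_app] at h2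
  exact epi_of_epi ((Sigma.ι P c).app c) _

/-- The homology functors `Hₙ(C, -)` of a small category `C` with coefficients in functors from
`C` to abelian groups: the left derived functors of the colimit functor. -/
noncomputable def categoryHomology (C : Type u) [SmallCategory C] (n : ℕ) :
    (C ⥤ AddCommGrpCat.{u}) ⥤ AddCommGrpCat.{u} :=
  (colim : (C ⥤ AddCommGrpCat.{u}) ⥤ AddCommGrpCat.{u}).leftDerived n

/-! ### Ordered groupoids -/

/-- A morphism of `G`, bundled with its source `dom` and its target `cod`. -/
@[ext]
structure Mor (G : Type u) [Quiver.{v} G] where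
  {dom : G}
  {cod : G}
  hom : dom ⟶ cod

namespace Mor

variable {G : Type u} [Groupoid.{u} G]

/-- The identity of `G` at the object `e`. -/
def id (e : G) : Mor G := ⟨𝟙 e⟩

/-- The inverse of a morphism. -/
def inv (x : Mor G) : Mor G := ⟨Groupoid.inv x.hom⟩

/-- The composite of `x` followed by `y`, when the target of `x` is the source of `y`. -/
def comp (x y : Mor G) (w : x.cod = y.dom) : Mor G := ⟨x.hom ≫ eqToHom w ≫ y.hom⟩

@[simp] lemma id_dom (e : G) : (id e).dom = e := rfl
@[simp] lemma id_cod (e : G) : (id e).cod = e := rfl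
@[simp] lemma inv_dom (x : Mor G) : x.inv.dom = x.cod := rfl
@[simp] lemma inv_cod (x : Mor G) : x.inv.cod = x.dom := rfl
@[simp] lemma comp_dom (x y : Mor G) (w : x.cod = y.dom) : (x.comp y w).dom = x.dom := rfl
@[simp] lemma comp_cod (x y : Mor G) (w : x.cod = y.dom) : (x.comp y w).cod = y.cod := rfl

lemma comp_assoc (x y z : Mor G) (w : x.cod = y.dom) (w' : y.cod = z.dom) :
    (x.comp y w).comp z w' = x.comp (y.comp z w') w := by
  simp [comp]

lemma id_comp (e : G) (x : Mor G) (w : e = x.dom) : (id e).comp x w = x := by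
  subst w
  simp [comp, id]

lemma comp_id (e : G) (x : Mor G) (w : x.cod = e) : x.comp (id e) w = x := by
  subst w
  simp [comp, id]

lemma inv_comp (x : Mor G) (w : x.inv.cod = x.dom) : x.inv.comp x w = id x.cod := by
  simp [comp, id, inv]

lemma comp_inv (x : Mor G) (w : x.cod = x.inv.dom) : x.comp x.inv w = id x.dom := by
  simp [comp, id, inv]

lemma inv_inv (x : Mor G) : x.inv.inv = x := by
  simp [inv]

end Mor

/-- An ordered groupoid: a (small) groupoid `G` with a partial order on its set of morphisms,
satisfying the axioms OG1 -- OG4. -/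
class OrderedGroupoid (G : Type u) extends Groupoid.{u} G where
  [morOrder : PartialOrder (Mor G)]
  inv_le_inv : ∀ x y : Mor G, x ≤ y → x.inv ≤ y.inv
  comp_le_comp : ∀ (x y a b : Mor G) (hxa : x.cod = a.dom) (hyb : y.cod = b.dom),
    x ≤ y → a ≤ b → x.comp a hxa ≤ y.comp b hyb
  existsUnique_restriction : ∀ (x : Mor G) (e : G), Mor.id e ≤ Mor.id x.dom →
    ∃! y : Mor G, y.dom = e ∧ y ≤ x
  existsUnique_corestriction : ∀ (x : Mor G) (e : G), Mor.id e ≤ Mor.id x.cod →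
    ∃! y : Mor G, y.cod = e ∧ y ≤ x

attribute [instance, reducible] OrderedGroupoid.morOrder

namespace OrderedGroupoid

section Basic

variable {G : Type u} [OrderedGroupoid G]

lemma id_dom_le {x y : Mor G} (h : x ≤ y) : Mor.id x.dom ≤ Mor.id y.dom := by
  have := comp_le_comp x y x.inv y.inv x.inv_dom.symm y.inv_dom.symm h (inv_le_inv x y h)
  rwa [Mor.comp_inv, Mor.comp_inv] at this

lemma id_cod_le {x y : Mor G} (h : x ≤ y) : Mor.id x.cod ≤ Mor.id y.cod :=
  id_dom_le (inv_le_inv x y h)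

lemma eq_of_le_of_dom {x y z : Mor G} (hx : x ≤ z) (hy : y ≤ z) (h : x.dom = y.dom) : x = y :=
  (existsUnique_restriction z y.dom (id_dom_le hy)).unique ⟨h, hx⟩ ⟨rfl, hy⟩

lemma eq_of_le_of_cod {x y z : Mor G} (hx : x ≤ z) (hy : y ≤ z) (h : x.cod = y.cod) : x = y :=
  (existsUnique_corestriction z y.cod (id_cod_le hy)).unique ⟨h, hx⟩ ⟨rfl, hy⟩

lemma eq_id_of_le {x : Mor G} {e : G} (h : x ≤ Mor.id e) : x = Mor.id x.dom :=
  eq_of_le_of_dom h (id_dom_le h) rfl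

/-- The restriction `(e|x)`. -/
noncomputable def restrict (e : G) (x : Mor G) (h : Mor.id e ≤ Mor.id x.dom) : Mor G :=
  (existsUnique_restriction x e h).choose

/-- The corestriction `(x|e)`. -/
noncomputable def corestrict (x : Mor G) (e : G) (h : Mor.id e ≤ Mor.id x.cod) : Mor G :=
  (existsUnique_corestriction x e h).choose

@[simp] lemma restrict_dom (e : G) (x : Mor G) (h : Mor.id e ≤ Mor.id x.dom) :
    (restrict e x h).dom = e := (existsUnique_restriction x e h).choose_spec.1.1

lemma restrict_le (e : G) (x : Mor G) (h : Mor.id e ≤ Mor.id x.dom) :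
    restrict e x h ≤ x := (existsUnique_restriction x e h).choose_spec.1.2

@[simp] lemma corestrict_cod (x : Mor G) (e : G) (h : Mor.id e ≤ Mor.id x.cod) :
    (corestrict x e h).cod = e := (existsUnique_corestriction x e h).choose_spec.1.1

lemma corestrict_le (x : Mor G) (e : G) (h : Mor.id e ≤ Mor.id x.cod) :
    corestrict x e h ≤ x := (existsUnique_corestriction x e h).choose_spec.1.2

end Basic

/-! ### The poset of identities and the category `𝔏(G)` -/

/-- The poset `E(G)` of identities of `G`, with the order inherited from `G`. -/
@[ext]
structure Idt (G : Type u) where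
  obj : G

instance (G : Type u) [OrderedGroupoid G] : PartialOrder (Idt G) :=
  PartialOrder.lift (fun e => Mor.id e.obj) fun e f h => by
    have := congrArg Mor.dom h
    exact Idt.ext this

/-- The objects of the category `𝔏(G)`: the identities of `G`. -/
@[ext]
structure LCat (G : Type u) where
  obj : G

section LCat

variable {G : Type u} [OrderedGroupoid G]

/-- The partial product `(g|hd)h`, defined when `hd ≤ gr`. -/
noncomputable def lcomp (g h : Mor G) (w : Mor.id h.dom ≤ Mor.id g.cod) : Mor G :=
  (corestrict g h.dom w).comp h (corestrict_cod _ _ _)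

@[simp] lemma lcomp_cod (g h : Mor G) (w : Mor.id h.dom ≤ Mor.id g.cod) :
    (lcomp g h w).cod = h.cod := rfl

lemma lcomp_dom_le (g h : Mor G) (w : Mor.id h.dom ≤ Mor.id g.cod) :
    Mor.id (lcomp g h w).dom ≤ Mor.id g.dom :=
  id_dom_le (x := corestrict g h.dom w) (corestrict_le g h.dom w)

lemma lcomp_eq {g h g' : Mor G} (w : Mor.id h.dom ≤ Mor.id g.cod) (hg : g' ≤ g)
    (w' : g'.cod = h.dom) : lcomp g h w = g'.comp h w' := by
  have : corestrict g h.dom w = g' :=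
    eq_of_le_of_cod (corestrict_le _ _ _) hg (by simp [w'])
  subst this
  rfl

lemma lcomp_assoc (g h k : Mor G) (w : Mor.id h.dom ≤ Mor.id g.cod)
    (w' : Mor.id k.dom ≤ Mor.id h.cod) :
    lcomp (lcomp g h w) k w' = lcomp g (lcomp h k w') ((lcomp_dom_le _ _ _).trans w) := by
  set h' := corestrict h k.dom w' with hh'
  have hle : h' ≤ h := corestrict_le _ _ _
  have hc : h'.cod = k.dom := corestrict_cod _ _ _
  set g' := corestrict g h.dom w with hg'
  have gle : g' ≤ g := corestrict_le _ _ _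
  have gc : g'.cod = h.dom := corestrict_cod _ _ _
  have w2 : Mor.id h'.dom ≤ Mor.id g'.cod := by rw [gc]; exact id_dom_le hle
  set g2 := corestrict g' h'.dom w2 with hg2
  have g2le : g2 ≤ g' := corestrict_le _ _ _
  have g2c : g2.cod = h'.dom := corestrict_cod _ _ _
  have e1 : lcomp (lcomp g h w) k w' = (g2.comp h' g2c).comp k hc :=
    lcomp_eq (g := lcomp g h w) w' (comp_le_comp g2 g' h' h g2c gc g2le hle) hc
  have e2 : lcomp g (lcomp h k w') ((lcomp_dom_le _ _ _).trans w) = g2.comp (h'.comp k hc) g2c :=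
    lcomp_eq (h := h'.comp k hc) _ (g2le.trans gle) g2c
  rw [e1, e2, Mor.comp_assoc]

/-- Morphisms `e ⟶ f` in `𝔏(G)` are the pairs `(e, g)` where the identity `gd` is below `e`,
and `gr = f`. -/
@[ext]
structure LHom (e f : LCat G) : Type u where
  g : Mor G
  dom_le : Mor.id g.dom ≤ Mor.id e.obj
  cod_eq : g.cod = f.obj

noncomputable instance : Category.{u} (LCat G) where
  Hom e f := LHom e f
  id e := ⟨Mor.id e.obj, le_rfl, rfl⟩
  comp g h := ⟨lcomp g.g h.g (by rw [g.cod_eq]; exact h.dom_le),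
    (lcomp_dom_le _ _ _).trans g.dom_le, h.cod_eq⟩
  id_comp {e f} g := LHom.ext ((lcomp_eq (g := Mor.id e.obj) (h := g.g)
    (g' := Mor.id g.g.dom) g.dom_le g.dom_le rfl).trans (Mor.id_comp _ _ _))
  comp_id {e f} g := LHom.ext ((lcomp_eq (g := g.g) (h := Mor.id f.obj)
    (g' := g.g) (by rw [g.cod_eq]; exact le_rfl) le_rfl g.cod_eq).trans (Mor.comp_id _ _ _))
  assoc g h k := LHom.ext (lcomp_assoc _ _ _ _ _)

/-- The arrow `(e, g)` of `𝔏(G)`, from `e` to `gr`. -/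
def larrow (e : G) (g : Mor G) (h : Mor.id g.dom ≤ Mor.id e) :
    (⟨e⟩ : LCat G) ⟶ ⟨g.cod⟩ := LHom.mk g h rfl

/-- The arrow `(e, f)` of `𝔏(G)`, from `e` to `f`, for identities `e ≥ f`. -/
def lres (e f : G) (h : Mor.id f ≤ Mor.id e) :
    (⟨e⟩ : LCat G) ⟶ ⟨f⟩ := LHom.mk (Mor.id f) h rfl

lemma larrow_comp (e : G) (g h : Mor G) (hg : Mor.id g.dom ≤ Mor.id e)
    (hh : Mor.id h.dom ≤ Mor.id g.cod) :
    larrow e g hg ≫ larrow g.cod h hh = larrow e (lcomp g h hh)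
      ((lcomp_dom_le _ _ _).trans hg) := rfl

lemma lres_self (e : G) : lres e e le_rfl = 𝟙 (⟨e⟩ : LCat G) := rfl

lemma lres_lres (e f k : G) (h : Mor.id f ≤ Mor.id e) (h' : Mor.id k ≤ Mor.id f) :
    lres e f h ≫ lres f k h' = lres e k (h'.trans h) :=
  LHom.ext ((lcomp_eq (g := Mor.id f) (h := Mor.id k) h' h' rfl).trans (Mor.id_comp _ _ _))

lemma lres_larrow (e f : G) (g : Mor G) (h : Mor.id f ≤ Mor.id e) (h' : Mor.id g.dom ≤ Mor.id f) :
    lres e f h ≫ larrow f g h' = larrow e g (h'.trans h) :=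
  LHom.ext ((lcomp_eq (g := Mor.id f) (h := g) (g' := Mor.id g.dom) h' h' rfl).trans
    (Mor.id_comp _ _ _))

lemma larrow_lres {e : G} {g k : Mor G} (h : Mor.id g.dom ≤ Mor.id e) (hk : k ≤ g) :
    larrow e g h ≫ lres g.cod k.cod (id_cod_le hk) = larrow e k ((id_dom_le hk).trans h) :=
  LHom.ext ((lcomp_eq (g := g) (h := Mor.id k.cod) (id_cod_le hk) hk rfl).trans
    (Mor.comp_id _ _ _))

variable (G) in
/-- The inclusion of `E(G)`, with one arrow `e → f` whenever `e ≥ f`, into `𝔏(G)`: the arrow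
`e → f` is sent to `(e, f)`. -/
noncomputable def idtToLCat : (Idt G)ᵒᵖ ⥤ LCat G where
  obj e := ⟨e.unop.obj⟩
  map {e f} i := lres e.unop.obj f.unop.obj (leOfHom i.unop)
  map_id _ := rfl
  map_comp i j := (lres_lres _ _ _ (leOfHom i.unop) (leOfHom j.unop)).symm

variable (G) in
/-- `G`-modules: functors from `𝔏(G)` to abelian groups. -/
abbrev GModule : Type (u + 1) := LCat G ⥤ AddCommGrpCat.{u}

variable (G) in
/-- The homology functors `Hₙ(G, -)` of an ordered groupoid, that is, those of `𝔏(G)`. -/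
noncomputable def homology (n : ℕ) : GModule G ⥤ AddCommGrpCat.{u} :=
  categoryHomology (LCat G) n

end LCat

/-! ### The relation `β` -/

/-- Two morphisms of `G` are `β`-related if they have a lower bound. -/
def Beta {G : Type u} [OrderedGroupoid G] (g h : Mor G) : Prop := ∃ k : Mor G, k ≤ g ∧ k ≤ h

/-- An ordered groupoid is principally directed if `β` is transitive. -/
class PrincipallyDirected (G : Type u) [OrderedGroupoid G] : Prop where
  beta_trans : ∀ g h k : Mor G, Beta g h → Beta h k → Beta g k

/-- `G` is principally directed if and only if every principal order ideal is (downwards)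
directed. -/
lemma principallyDirected_iff (G : Type u) [OrderedGroupoid G] :
    PrincipallyDirected G ↔ ∀ t : Mor G, DirectedOn (· ≥ ·) (Set.Iic t) := by
  constructor
  · intro hG t g hg h hh
    obtain ⟨k, h1, h2⟩ := hG.beta_trans g t h ⟨g, le_rfl, hg⟩ ⟨h, hh, le_rfl⟩
    exact ⟨k, h1.trans hg, h1, h2⟩
  · intro hG
    refine ⟨fun g t h => ?_⟩
    rintro ⟨k, kg, kt⟩ ⟨l, lt, lh⟩
    obtain ⟨c, -, ck, cl⟩ := hG t k kt l lt
    exact ⟨c, le_trans ck kg, le_trans cl lh⟩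

section Beta

variable {G : Type u} [OrderedGroupoid G]

lemma Beta.of_le {g h : Mor G} (w : g ≤ h) : Beta g h := ⟨g, le_rfl, w⟩

lemma Beta.symm {g h : Mor G} (w : Beta g h) : Beta h g := ⟨w.choose, w.choose_spec.2, w.choose_spec.1⟩

lemma Beta.dom {g h : Mor G} (w : Beta g h) : Beta (Mor.id g.dom) (Mor.id h.dom) :=
  ⟨_, id_dom_le w.choose_spec.1, id_dom_le w.choose_spec.2⟩

lemma Beta.cod {g h : Mor G} (w : Beta g h) : Beta (Mor.id g.cod) (Mor.id h.cod) :=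
  ⟨_, id_cod_le w.choose_spec.1, id_cod_le w.choose_spec.2⟩

lemma Beta.inv {g h : Mor G} (w : Beta g h) : Beta g.inv h.inv :=
  ⟨_, inv_le_inv _ _ w.choose_spec.1, inv_le_inv _ _ w.choose_spec.2⟩

/-- `β`-related identities have an identity as a lower bound. -/
lemma Beta.exists_id {e f : G} (w : Beta (Mor.id e) (Mor.id f)) :
    ∃ l : G, Mor.id l ≤ Mor.id e ∧ Mor.id l ≤ Mor.id f :=
  ⟨w.choose.dom, id_dom_le w.choose_spec.1, id_dom_le w.choose_spec.2⟩

variable [PrincipallyDirected G]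

lemma Beta.trans {g h k : Mor G} (w : Beta g h) (w' : Beta h k) : Beta g k :=
  PrincipallyDirected.beta_trans g h k w w'

variable (G) in
/-- `β` as an equivalence relation on the morphisms of `G`. -/
def betaSetoid : Setoid (Mor G) where
  r := Beta
  iseqv := ⟨fun g => Beta.of_le le_rfl, Beta.symm, Beta.trans⟩

variable (G) in
/-- `β` restricted to the identities of `G`. -/
def betaIdtSetoid : Setoid (Idt G) where
  r e f := Beta (Mor.id e.obj) (Mor.id f.obj)
  iseqv := ⟨fun _ => Beta.of_le le_rfl, Beta.symm, Beta.trans⟩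

/-- The composites `(g|f)(f|h)` of `β`-related data are `β`-related. -/
lemma beta_comp {g h g' h' : Mor G} (hg : Beta g g') (hh : Beta h h') {x y x' y' : Mor G}
    (hx : x ≤ g) (hy : y ≤ h) (hx' : x' ≤ g') (hy' : y' ≤ h')
    (w : x.cod = y.dom) (w' : x'.cod = y'.dom) : Beta (x.comp y w) (x'.comp y' w') := by
  obtain ⟨k, kx, kx'⟩ := ((Beta.of_le hx).trans hg).trans (Beta.of_le hx').symm
  obtain ⟨l, ly, ly'⟩ := ((Beta.of_le hy).trans hh).trans (Beta.of_le hy').symm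
  have hkl : Beta (Mor.id k.cod) (Mor.id l.dom) :=
    (Beta.of_le (id_cod_le kx)).trans
      (by rw [w]; exact (Beta.of_le (id_dom_le ly)).symm)
  obtain ⟨m, mk, ml⟩ := hkl.exists_id
  exact ⟨(corestrict k m mk).comp (restrict m l ml) (by simp),
    comp_le_comp _ _ _ _ _ _ ((corestrict_le _ _ _).trans kx) ((restrict_le _ _ _).trans ly),
    comp_le_comp _ _ _ _ _ _ ((corestrict_le _ _ _).trans kx') ((restrict_le _ _ _).trans ly')⟩

end Beta

/-! ### The quotient groupoid `G/β` -/

/-- The set of objects (identities) of `G/β`: the `β`-classes of identities of `G`. -/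
def QuotBeta (G : Type u) [OrderedGroupoid G] [PrincipallyDirected G] : Type u :=
  Quotient (betaIdtSetoid G)

section Quotient

variable {G : Type u} [OrderedGroupoid G] [PrincipallyDirected G]

/-- The class `eβ` of an identity `e`. -/
def QuotBeta.mk (e : G) : QuotBeta G := Quotient.mk (betaIdtSetoid G) ⟨e⟩

lemma QuotBeta.mk_eq_mk {e f : G} :
    (QuotBeta.mk e : QuotBeta G) = QuotBeta.mk f ↔ Beta (Mor.id e) (Mor.id f) :=
  Quotient.eq (r := betaIdtSetoid G)

variable (G) in
/-- The set of morphisms of `G/β`: the `β`-classes of morphisms of `G`. -/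
def QuotMor : Type u := Quotient (betaSetoid G)

/-- The class `gβ` of a morphism `g`. -/
def QuotMor.mk (g : Mor G) : QuotMor G := Quotient.mk (betaSetoid G) g

lemma QuotMor.mk_eq_mk {g h : Mor G} : QuotMor.mk g = QuotMor.mk h ↔ Beta g h :=
  Quotient.eq (r := betaSetoid G)

lemma QuotMor.mk_out (q : QuotMor G) : QuotMor.mk (Quotient.out q) = q := Quotient.out_eq q

/-- The source of a morphism of `G/β`. -/
def QuotMor.dom (q : QuotMor G) : QuotBeta G :=
  Quotient.lift (fun g : Mor G => QuotBeta.mk g.dom)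
    (fun _ _ h => QuotBeta.mk_eq_mk.2 (Beta.dom h)) q

/-- The target of a morphism of `G/β`. -/
def QuotMor.cod (q : QuotMor G) : QuotBeta G :=
  Quotient.lift (fun g : Mor G => QuotBeta.mk g.cod)
    (fun _ _ h => QuotBeta.mk_eq_mk.2 (Beta.cod h)) q

@[simp] lemma QuotMor.mk_dom (g : Mor G) : (QuotMor.mk g).dom = QuotBeta.mk g.dom := rfl
@[simp] lemma QuotMor.mk_cod (g : Mor G) : (QuotMor.mk g).cod = QuotBeta.mk g.cod := rfl

/-- The class of an inverse. -/
def QuotMor.inv (q : QuotMor G) : QuotMor G :=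
  Quotient.lift (fun g : Mor G => QuotMor.mk g.inv)
    (fun _ _ h => QuotMor.mk_eq_mk.2 (Beta.inv h)) q

/-- The identity of `G/β` at the object `a`. -/
def QuotMor.id (a : QuotBeta G) : QuotMor G :=
  Quotient.lift (fun e : Idt G => QuotMor.mk (Mor.id e.obj))
    (fun _ _ h => QuotMor.mk_eq_mk.2 h) a

lemma QuotMor.exists_id {p q : QuotMor G} (w : p.cod = q.dom) : ∃ f : G,
    Mor.id f ≤ Mor.id (Quotient.out p).cod ∧ Mor.id f ≤ Mor.id (Quotient.out q).dom := by
  rw [← p.mk_out, ← q.mk_out] at w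
  exact (QuotBeta.mk_eq_mk.1 w).exists_id

/-- The composite of the `β`-classes of `g` and `h`: the `β`-class of `(g|f)(f|h)`, for an
identity `f` below `gr` and `hd`. -/
noncomputable def QuotMor.comp (p q : QuotMor G) (w : p.cod = q.dom) : QuotMor G :=
  QuotMor.mk ((corestrict (Quotient.out p) (exists_id w).choose (exists_id w).choose_spec.1).comp
    (restrict (exists_id w).choose (Quotient.out q) (exists_id w).choose_spec.2) (by simp))

/-- The composition in `G/β` does not depend on the choices. -/
lemma QuotMor.mk_comp_mk {g h x y : Mor G} (hx : x ≤ g) (hy : y ≤ h) (w : x.cod = y.dom)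
    (w' : (QuotMor.mk g).cod = (QuotMor.mk h).dom) :
    (QuotMor.mk g).comp (QuotMor.mk h) w' = QuotMor.mk (x.comp y w) := by
  refine QuotMor.mk_eq_mk.2 (beta_comp (g := Quotient.out (QuotMor.mk g))
    (h := Quotient.out (QuotMor.mk h)) (QuotMor.mk_eq_mk.1 (QuotMor.mk_out _))
    (QuotMor.mk_eq_mk.1 (QuotMor.mk_out _)) (corestrict_le _ _ _) (restrict_le _ _ _) hx hy _ _)

/-- Each morphism class has a representative whose source lies below any given identity in the
source class. -/
lemma QuotMor.exists_rep (q : QuotMor G) (e : G) (h : q.dom = QuotBeta.mk e) :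
    ∃ m : Mor G, Mor.id m.dom ≤ Mor.id e ∧ QuotMor.mk m = q := by
  induction q using Quotient.inductionOn with
  | h g =>
    obtain ⟨l, l1, l2⟩ := (QuotBeta.mk_eq_mk.1 h).exists_id
    exact ⟨restrict l g l1, by simpa using l2,
      QuotMor.mk_eq_mk.2 (Beta.of_le (restrict_le _ _ _))⟩

lemma QuotMor.comp_dom (p q : QuotMor G) (w : p.cod = q.dom) : (p.comp q w).dom = p.dom := by
  conv_rhs => rw [← p.mk_out]
  exact QuotBeta.mk_eq_mk.2 (Beta.of_le (corestrict_le _ _ _)).dom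

lemma QuotMor.comp_cod (p q : QuotMor G) (w : p.cod = q.dom) : (p.comp q w).cod = q.cod := by
  conv_rhs => rw [← q.mk_out]
  exact QuotBeta.mk_eq_mk.2 (Beta.of_le (restrict_le _ _ _)).cod

lemma QuotMor.id_dom (a : QuotBeta G) : (QuotMor.id a).dom = a := by
  induction a using Quotient.inductionOn with
  | h e => rfl

lemma QuotMor.id_cod (a : QuotBeta G) : (QuotMor.id a).cod = a := by
  induction a using Quotient.inductionOn with
  | h e => rfl

lemma QuotMor.inv_dom (q : QuotMor G) : q.inv.dom = q.cod := by
  induction q using Quotient.inductionOn with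
  | h g => rfl

lemma QuotMor.inv_cod (q : QuotMor G) : q.inv.cod = q.dom := by
  induction q using Quotient.inductionOn with
  | h g => rfl

lemma QuotMor.id_comp (q : QuotMor G) (a : QuotBeta G) (w : (QuotMor.id a).cod = q.dom) :
    (QuotMor.id a).comp q w = q := by
  rw [QuotMor.id_cod] at w
  subst w
  induction q using Quotient.inductionOn with
  | h g =>
    exact (QuotMor.mk_comp_mk (g := Mor.id g.dom) (h := g) le_rfl le_rfl rfl rfl).trans
      (congrArg QuotMor.mk (Mor.id_comp _ _ _))

lemma QuotMor.comp_id (q : QuotMor G) (a : QuotBeta G) (w : q.cod = (QuotMor.id a).dom) :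
    q.comp (QuotMor.id a) w = q := by
  rw [QuotMor.id_dom] at w
  subst w
  induction q using Quotient.inductionOn with
  | h g =>
    exact (QuotMor.mk_comp_mk (g := g) (h := Mor.id g.cod) le_rfl le_rfl rfl rfl).trans
      (congrArg QuotMor.mk (Mor.comp_id _ _ _))

lemma QuotMor.comp_inv (q : QuotMor G) : q.comp q.inv q.inv_dom.symm = QuotMor.id q.dom := by
  induction q using Quotient.inductionOn with
  | h g =>
    exact (QuotMor.mk_comp_mk (g := g) (h := g.inv) le_rfl le_rfl rfl rfl).trans
      (congrArg QuotMor.mk (Mor.comp_inv _ _))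

lemma QuotMor.inv_comp (q : QuotMor G) : q.inv.comp q q.inv_cod = QuotMor.id q.cod := by
  induction q using Quotient.inductionOn with
  | h g =>
    exact (QuotMor.mk_comp_mk (g := g.inv) (h := g) le_rfl le_rfl rfl rfl).trans
      (congrArg QuotMor.mk (Mor.inv_comp _ _))

lemma QuotMor.comp_assoc (p q r : QuotMor G) (w : p.cod = q.dom) (w' : q.cod = r.dom) :
    (p.comp q w).comp r ((p.comp_cod q w).trans w') =
      p.comp (q.comp r w') (w.trans (q.comp_dom r w').symm) := by
  obtain ⟨g, rfl⟩ : ∃ g, QuotMor.mk g = p := ⟨_, p.mk_out⟩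
  obtain ⟨h, hh, rfl⟩ := q.exists_rep g.cod w.symm
  obtain ⟨k, hk, rfl⟩ := r.exists_rep h.cod w'.symm
  set h' := corestrict h k.dom hk with hh'
  have hle : h' ≤ h := corestrict_le _ _ _
  have hc : h'.cod = k.dom := corestrict_cod _ _ _
  set g' := corestrict g h.dom hh with hg'
  have gle : g' ≤ g := corestrict_le _ _ _
  have gc : g'.cod = h.dom := corestrict_cod _ _ _
  have w2 : Mor.id h'.dom ≤ Mor.id g'.cod := by rw [gc]; exact id_dom_le hle
  set g2 := corestrict g' h'.dom w2 with hg2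
  have g2le : g2 ≤ g' := corestrict_le _ _ _
  have g2c : g2.cod = h'.dom := corestrict_cod _ _ _
  have e1 := QuotMor.mk_comp_mk (g2le.trans gle) hle g2c w
  have e2 := QuotMor.mk_comp_mk hle (le_refl k) hc w'
  calc _ = (QuotMor.mk (g2.comp h' g2c)).comp (QuotMor.mk k)
        (by rw [← e1, QuotMor.comp_cod]; exact w') := by congr 1
    _ = QuotMor.mk ((g2.comp h' g2c).comp k hc) :=
      QuotMor.mk_comp_mk (x := g2.comp h' g2c) le_rfl le_rfl hc _
    _ = QuotMor.mk (g2.comp (h'.comp k hc) g2c) := by rw [Mor.comp_assoc]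
    _ = (QuotMor.mk g).comp (QuotMor.mk (h'.comp k hc))
        (by rw [← e2, QuotMor.comp_dom]; exact w) :=
      (QuotMor.mk_comp_mk (y := h'.comp k hc) (g2le.trans gle) le_rfl g2c _).symm
    _ = _ := by congr 1; exact e2.symm

/-- The morphisms `a ⟶ b` of `G/β`. -/
@[ext]
structure QuotHom (a b : QuotBeta G) : Type u where
  q : QuotMor G
  dom_eq : q.dom = a
  cod_eq : q.cod = b

lemma QuotHom.mk_cod {a b : QuotBeta G} (p : QuotHom a b) {m : Mor G} (h : QuotMor.mk m = p.q) :
    QuotBeta.mk m.cod = b := by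
  rw [← QuotMor.mk_cod, h, p.cod_eq]

/-- The identity of `G/β` at `a`. -/
def QuotHom.id (a : QuotBeta G) : QuotHom a a :=
  ⟨QuotMor.id a, QuotMor.id_dom a, QuotMor.id_cod a⟩

/-- The composition of `G/β`. -/
noncomputable def QuotHom.comp {a b c : QuotBeta G} (p : QuotHom a b) (q : QuotHom b c) :
    QuotHom a c :=
  ⟨p.q.comp q.q (p.cod_eq.trans q.dom_eq.symm),
    (QuotMor.comp_dom _ _ _).trans p.dom_eq, (QuotMor.comp_cod _ _ _).trans q.cod_eq⟩

/-- The inverses of `G/β`. -/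
def QuotHom.inv {a b : QuotBeta G} (p : QuotHom a b) : QuotHom b a :=
  ⟨p.q.inv, p.q.inv_dom.trans p.cod_eq, p.q.inv_cod.trans p.dom_eq⟩

/-- The quotient groupoid `G/β`. -/
noncomputable instance : Groupoid.{u} (QuotBeta G) where
  Hom a b := QuotHom a b
  id a := QuotHom.id a
  comp p q := QuotHom.comp p q
  id_comp {a b} p := QuotHom.ext (QuotMor.id_comp p.q a ((QuotMor.id_cod a).trans p.dom_eq.symm))
  comp_id {a b} p := QuotHom.ext (QuotMor.comp_id p.q b (p.cod_eq.trans (QuotMor.id_dom b).symm))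
  assoc p q r := QuotHom.ext (QuotMor.comp_assoc p.q q.q r.q (p.cod_eq.trans q.dom_eq.symm)
    (q.cod_eq.trans r.dom_eq.symm))
  inv p := QuotHom.inv p
  inv_comp p := QuotHom.ext (by
    obtain ⟨q, rfl, rfl⟩ := p
    exact QuotMor.inv_comp q)
  comp_inv p := QuotHom.ext (by
    obtain ⟨q, rfl, rfl⟩ := p
    exact QuotMor.comp_inv q)

end Quotient

/-! ### The `G/β`-module `colim^{E(G)} A` -/

section Colim

variable {G : Type u} [OrderedGroupoid G] [PrincipallyDirected G]

/-- The identities of `G` in the `β`-class `x`, as a subposet of `E(G)`. -/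
abbrev IdtClass (x : QuotBeta G) : Type u := {e : Idt G // QuotBeta.mk e.obj = x}

/-- The restriction of a `G`-module to the identities in the `β`-class `x`, using only the maps
`A_e ⟶ A_f` for `e ≥ f`. -/
noncomputable def classDiagram (A : GModule G) (x : QuotBeta G) :
    (IdtClass x)ᵒᵖ ⥤ AddCommGrpCat.{u} :=
  (Subtype.mono_coe (fun e : Idt G => QuotBeta.mk e.obj = x)).functor.op ⋙ idtToLCat G ⋙ A

/-- The direct summand `L_x` of `colim^{E(G)} A` belonging to the `β`-class `x`. -/
noncomputable def colimClass (A : GModule G) (x : QuotBeta G) : AddCommGrpCat.{u} :=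
  colimit (classDiagram A x)

/-- The canonical map `α_e : A_e ⟶ L_x`, for `e` in the class `x`. -/
noncomputable def toColimClass (A : GModule G) (e : G) (x : QuotBeta G)
    (h : QuotBeta.mk e = x) : A.obj ⟨e⟩ ⟶ colimClass A x :=
  colimit.ι (classDiagram A x) (op ⟨⟨e⟩, h⟩)

lemma map_toColimClass (A : GModule G) {e f : G} (w : Mor.id f ≤ Mor.id e) (x : QuotBeta G)
    (he : QuotBeta.mk e = x) (hf : QuotBeta.mk f = x) :
    A.map (lres e f w) ≫ toColimClass A f x hf = toColimClass A e x he :=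
  colimit.w (classDiagram A x) (Quiver.Hom.op (homOfLE
    (show (⟨⟨f⟩, hf⟩ : IdtClass x) ≤ ⟨⟨e⟩, he⟩ from w)))

/-- `a ↦ (a ◁ (e, m)) α_z`, where `z = mr`, depends only on the `β`-class of `m`. -/
lemma act_congr (A : GModule G) {e : G} {m m' : Mor G} (h : Mor.id m.dom ≤ Mor.id e)
    (h' : Mor.id m'.dom ≤ Mor.id e) (w : Beta m m') (x : QuotBeta G)
    (hm : QuotBeta.mk m.cod = x) (hm' : QuotBeta.mk m'.cod = x) :
    A.map (larrow e m h) ≫ toColimClass A m.cod x hm =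
      A.map (larrow e m' h') ≫ toColimClass A m'.cod x hm' := by
  obtain ⟨k, hk, hk'⟩ := w
  have key : ∀ (n : Mor G) (hn : Mor.id n.dom ≤ Mor.id e) (hx : QuotBeta.mk n.cod = x)
      (hkn : k ≤ n), A.map (larrow e n hn) ≫ toColimClass A n.cod x hx =
        A.map (larrow e k ((id_dom_le hkn).trans hn)) ≫ toColimClass A k.cod x
          ((QuotBeta.mk_eq_mk.2 (Beta.of_le hkn).cod).trans hx) := by
    intro n hn hx hkn
    have hkx := (QuotBeta.mk_eq_mk.2 (Beta.of_le hkn).cod).trans hx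
    rw [← map_toColimClass A (id_cod_le hkn) x hx hkx, ← Category.assoc, ← A.map_comp,
      larrow_lres hn hkn]
  rw [key m h hm hk, key m' h' hm' hk']

/-- A representative of the class `q` whose source lies below `e`. -/
noncomputable def rep (q : QuotMor G) (e : G) (h : q.dom = QuotBeta.mk e) : Mor G :=
  (q.exists_rep e h).choose

lemma rep_dom_le (q : QuotMor G) (e : G) (h : q.dom = QuotBeta.mk e) :
    Mor.id (rep q e h).dom ≤ Mor.id e := (q.exists_rep e h).choose_spec.1

lemma mk_rep (q : QuotMor G) (e : G) (h : q.dom = QuotBeta.mk e) :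
    QuotMor.mk (rep q e h) = q := (q.exists_rep e h).choose_spec.2

/-- The action of `gβ` on `A_e`: it sends `a` to `(a ◁ (e, m)) α_z`, where `m` represents `gβ` and
has source `ℓ ≤ e` (so that `(e, m) = (e, ℓ)(ℓ, m)`), and `z = mr`. -/
noncomputable def actOn (A : GModule G) {x y : QuotBeta G} (q : QuotHom x y) (e : G)
    (h : QuotBeta.mk e = x) : A.obj ⟨e⟩ ⟶ colimClass A y :=
  A.map (larrow e (rep q.q e (q.dom_eq.trans h.symm)) (rep_dom_le _ _ _)) ≫
    toColimClass A (rep q.q e (q.dom_eq.trans h.symm)).cod y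
      (q.mk_cod (mk_rep _ _ _))

lemma actOn_eq (A : GModule G) {x y : QuotBeta G} (q : QuotHom x y) (e : G)
    (h : QuotBeta.mk e = x) (m : Mor G) (hm : Mor.id m.dom ≤ Mor.id e) (hq : QuotMor.mk m = q.q) :
    actOn A q e h = A.map (larrow e m hm) ≫ toColimClass A m.cod y (q.mk_cod hq) :=
  act_congr A _ _ (QuotMor.mk_eq_mk.1 ((mk_rep _ _ _).trans hq.symm)) _ _ _

lemma map_actOn (A : GModule G) {x y : QuotBeta G} (q : QuotHom x y) {e f : G}
    (w : Mor.id f ≤ Mor.id e) (he : QuotBeta.mk e = x) (hf : QuotBeta.mk f = x) :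
    A.map (lres e f w) ≫ actOn A q f hf = actOn A q e he := by
  obtain ⟨m, hm, hq⟩ := q.q.exists_rep f (q.dom_eq.trans hf.symm)
  rw [actOn_eq A q f hf m hm hq, actOn_eq A q e he m (hm.trans w) hq, ← Category.assoc,
    ← A.map_comp, lres_larrow]

/-- The action `L_x ⟶ L_y` of a morphism `x ⟶ y` of `G/β`. -/
noncomputable def act (A : GModule G) {x y : QuotBeta G} (q : QuotHom x y) :
    colimClass A x ⟶ colimClass A y :=
  colimit.desc (classDiagram A x)
    { pt := colimClass A y
      ι :=
        { app := fun e => actOn A q e.unop.1.obj e.unop.2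
          naturality := fun e f i => by
            refine Eq.trans ?_ (Category.comp_id _).symm
            exact map_actOn A q (leOfHom i.unop) e.unop.2 f.unop.2 } }

lemma toColimClass_act (A : GModule G) {x y : QuotBeta G} (q : QuotHom x y) (e : G)
    (h : QuotBeta.mk e = x) : toColimClass A e x h ≫ act A q = actOn A q e h :=
  colimit.ι_desc (F := classDiagram A x) _ (op ⟨⟨e⟩, h⟩)

lemma colimClass_hom_ext (A : GModule G) {x : QuotBeta G} {M : AddCommGrpCat.{u}}
    {s t : colimClass A x ⟶ M}
    (h : ∀ (e : G) (he : QuotBeta.mk e = x), toColimClass A e x he ≫ s = toColimClass A e x he ≫ t) :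
    s = t :=
  colimit.hom_ext fun e => h e.unop.1.obj e.unop.2

lemma act_id (A : GModule G) (x : QuotBeta G) : act A (QuotHom.id x) = 𝟙 _ := by
  refine colimClass_hom_ext A fun e he => ?_
  rw [toColimClass_act, actOn_eq A (QuotHom.id x) e he (Mor.id e) le_rfl (by subst he; rfl),
    Category.comp_id]
  exact map_toColimClass A le_rfl x he he

lemma act_comp (A : GModule G) {x y z : QuotBeta G} (p : QuotHom x y) (q : QuotHom y z) :
    act A (p.comp q) = act A p ≫ act A q := by
  refine colimClass_hom_ext A fun e he => ?_
  obtain ⟨g, hg, hp⟩ := p.q.exists_rep e (p.dom_eq.trans he.symm)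
  have hgy : QuotBeta.mk g.cod = y := p.mk_cod hp
  obtain ⟨h, hh, hq⟩ := q.q.exists_rep g.cod (q.dom_eq.trans hgy.symm)
  have hpq : QuotMor.mk (lcomp g h hh) = (p.comp q).q := by
    refine (QuotMor.mk_comp_mk (corestrict_le g h.dom hh) le_rfl (corestrict_cod _ _ _)
      (hgy.trans (q.dom_eq.symm.trans (congrArg QuotMor.dom hq.symm)))).symm.trans ?_
    unfold QuotHom.comp
    congr 1
  rw [← Category.assoc, toColimClass_act, toColimClass_act, actOn_eq A p e he g hg hp,
    Category.assoc, toColimClass_act, actOn_eq A q g.cod hgy h hh hq,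
    actOn_eq A (p.comp q) e he (lcomp g h hh) ((lcomp_dom_le _ _ _).trans hg) hpq,
    ← Category.assoc, ← A.map_comp, larrow_comp]
  rfl

/-- The `G/β`-module `colim^{E(G)} A`. -/
noncomputable def colimIdtObj (A : GModule G) : QuotBeta G ⥤ AddCommGrpCat.{u} where
  obj x := colimClass A x
  map q := act A q
  map_id x := act_id A x
  map_comp p q := act_comp A p q

/-- The map `L_x ⟶ L'_x` induced by a morphism of `G`-modules. -/
noncomputable def colimClassMap {A B : GModule G} (φ : A ⟶ B) (x : QuotBeta G) :
    colimClass A x ⟶ colimClass B x :=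
  colim.map (Functor.whiskerLeft _ (Functor.whiskerLeft _ φ) :
    classDiagram A x ⟶ classDiagram B x)

lemma toColimClass_map {A B : GModule G} (φ : A ⟶ B) (e : G) (x : QuotBeta G)
    (he : QuotBeta.mk e = x) :
    toColimClass A e x he ≫ colimClassMap φ x = φ.app ⟨e⟩ ≫ toColimClass B e x he :=
  colimit.ι_map (Functor.whiskerLeft _ (Functor.whiskerLeft _ φ) :
    classDiagram A x ⟶ classDiagram B x) (op ⟨⟨e⟩, he⟩)

lemma act_colimClassMap {A B : GModule G} (φ : A ⟶ B) {x y : QuotBeta G} (q : QuotHom x y) :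
    act A q ≫ colimClassMap φ y = colimClassMap φ x ≫ act B q := by
  refine colimClass_hom_ext A fun e he => ?_
  obtain ⟨m, hm, hq⟩ := q.q.exists_rep e (q.dom_eq.trans he.symm)
  rw [← Category.assoc, toColimClass_act, ← Category.assoc, toColimClass_map, Category.assoc,
    toColimClass_act, actOn_eq A q e he m hm hq, actOn_eq B q e he m hm hq,
    Category.assoc, toColimClass_map, ← Category.assoc, ← Category.assoc, φ.naturality]

lemma colimClassMap_id (A : GModule G) (x : QuotBeta G) : colimClassMap (𝟙 A) x = 𝟙 _ := by
  refine colimClass_hom_ext A fun e he => ?_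
  rw [toColimClass_map, NatTrans.id_app, Category.id_comp, Category.comp_id]

lemma colimClassMap_comp {A B D : GModule G} (φ : A ⟶ B) (ψ : B ⟶ D) (x : QuotBeta G) :
    colimClassMap (φ ≫ ψ) x = colimClassMap φ x ≫ colimClassMap ψ x := by
  refine colimClass_hom_ext A fun e he => ?_
  rw [toColimClass_map, NatTrans.comp_app, ← Category.assoc, toColimClass_map, Category.assoc,
    Category.assoc, toColimClass_map]

variable (G) in
/-- The functor `colim^{E(G)}` from `G`-modules to `G/β`-modules. -/
noncomputable def colimIdt : GModule G ⥤ (QuotBeta G ⥤ AddCommGrpCat.{u}) where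
  obj A := colimIdtObj A
  map φ :=
    { app := fun x => colimClassMap φ x
      naturality := fun _ _ q => act_colimClassMap φ q }
  map_id A := NatTrans.ext (funext fun x => colimClassMap_id A x)
  map_comp φ ψ := NatTrans.ext (funext fun x => colimClassMap_comp φ ψ x)

end Colim

end OrderedGroupoid

/-! Sending an arrow (e, g) of 𝔏(G) to gβ defines a functor `lcatToQuot` from 𝔏(G) to G/β, and
`colimIdt` is the left Kan extension along it, that is, the left adjoint of restriction of modules
(`colimIdtAdjunction`). A colimit over 𝔏(G) is therefore a colimit over G/β of `colimIdt`
(`colimIsoColimIdtComp`). In general such a factorisation gives only a spectral sequence. Here it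
collapses, because `colimIdt` is exact and preserves projectives: it carries a projective resolution
of A to a projective resolution of its image, and taking colimits of the two gives isomorphic
complexes (`Functor.leftDerivedCompObjIso`).

Exactness is where principal directedness enters homologically. Transitivity of β makes each β-class
of identities downwards directed, so each L_x is a filtered colimit of abelian groups. Projectives
are preserved because the right adjoint, restriction, preserves epimorphisms. The adjunction itself
rests on the fact that every arrow of G/β out of the class of e is the image of an arrow of 𝔏(G) out
of e. -/

section DerivedFunctors

universe v₁ v₂ v₃ u₁ u₂ u₃

/-! ### Left derived functors of a composite with an exact functor -/

variable {C : Type u₁} [Category.{v₁} C] [Abelian C] {D : Type u₂} [Category.{v₂} D] [Abelian D]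
  {E : Type u₃} [Category.{v₃} E] [Abelian E]

/-- The image of a projective resolution under an exact functor preserving projective objects. -/
noncomputable def CategoryTheory.ProjectiveResolution.mapOfExact {X : C}
    (P : ProjectiveResolution X) (F : C ⥤ D) [F.Additive] [F.PreservesHomology]
    [F.PreservesProjectiveObjects] : ProjectiveResolution (F.obj X) where
  complex := (F.mapHomologicalComplex _).obj P.complex
  projective n := F.projective_obj (P.complex.X n)
  -- This is still a quasi-isomorphism, as instance inference finds: `F` preserves homology, and the
  -- second factor is an isomorphism.
  π := (F.mapHomologicalComplex _).map P.π ≫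
    (HomologicalComplex.singleMapHomologicalComplex F (ComplexShape.down ℕ) 0).hom.app X

/-- The left derived functors of `F ⋙ H` are those of `H`, applied to the values of `F`, when `F`
is exact and preserves projective objects. -/
noncomputable def CategoryTheory.Functor.leftDerivedCompObjIso [HasProjectiveResolutions C]
    [HasProjectiveResolutions D] (F : C ⥤ D) [F.Additive] [F.PreservesHomology]
    [F.PreservesProjectiveObjects] (H : D ⥤ E) [H.Additive] (K : C ⥤ E) [K.Additive]
    (e : K ≅ F ⋙ H) (n : ℕ) (X : C) :
    (K.leftDerived n).obj X ≅ (H.leftDerived n).obj (F.obj X) :=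
  -- A single resolution of `X` computes both sides: `K` is applied to it directly and `H` to its
  -- image under `F`, and `e` identifies the two complexes.
  (projectiveResolution X).isoLeftDerivedObj K n ≪≫
    (HomologicalComplex.homologyFunctor E _ n).mapIso
      ((NatIso.mapHomologicalComplex e _).app (projectiveResolution X).complex) ≪≫
    (((projectiveResolution X).mapOfExact F).isoLeftDerivedObj H n).symm

end DerivedFunctors

namespace OrderedGroupoid

/-! ### Directedness of the β-classes of identities -/

variable {G : Type u} [OrderedGroupoid G] [PrincipallyDirected G]

instance (x : QuotBeta G) : Nonempty (IdtClass x) := by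
  induction x using Quotient.inductionOn with
  | h e => exact ⟨⟨e, rfl⟩⟩

/-- Since β is transitive, two identities in one class have a common lower bound instead of being
merely joined by a zigzag. Together with nonemptiness this makes the index category of L_x filtered.
-/
instance (x : QuotBeta G) : IsCodirectedOrder (IdtClass x) where
  directed e f := by
    obtain ⟨l, hle, hlf⟩ := (QuotBeta.mk_eq_mk.1 (e.2.trans f.2.symm)).exists_id
    exact ⟨⟨⟨l⟩, (QuotBeta.mk_eq_mk.2 (Beta.of_le hle)).trans e.2⟩, hle, hlf⟩

/-! ### The functor from 𝔏(G) to G/β -/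

/-- The class `gβ` of an arrow `(e, g)` of `𝔏(G)`. -/
def toQuotHom {e f : LCat G} (g : e ⟶ f) : QuotHom (QuotBeta.mk e.obj) (QuotBeta.mk f.obj) :=
  ⟨QuotMor.mk g.g, QuotBeta.mk_eq_mk.2 (Beta.of_le g.dom_le), congrArg QuotBeta.mk g.cod_eq⟩

variable (G) in
/-- The functor from `𝔏(G)` to `G/β` sending `(e, g)` to `gβ`. -/
noncomputable def lcatToQuot : LCat G ⥤ QuotBeta G where
  obj e := QuotBeta.mk e.obj
  map g := toQuotHom g
  map_id _ := rfl
  -- The composite (g|f)h in 𝔏(G), with f the source of h, is an admissible choice of representative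
  -- for the product in G/β; h itself needs no restriction.
  map_comp g h := QuotHom.ext (QuotMor.mk_comp_mk (corestrict_le _ _ _) le_rfl _
    ((toQuotHom g).cod_eq.trans (toQuotHom h).dom_eq.symm)).symm

/-- The morphism underlying `g` is itself a representative of its β-class with source below `e`, so
it may be used to compute the action on the image of A_e. -/
lemma map_toColimClass_eq_act (A : GModule G) {e f : LCat G} (g : e ⟶ f) :
    A.map g ≫ toColimClass A f.obj _ rfl = toColimClass A e.obj _ rfl ≫ act A (toQuotHom g) := by
  rw [toColimClass_act]
  obtain ⟨f⟩ := f
  obtain ⟨m, hm, w⟩ := g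
  -- Once the target is literally `m.cod`, the arrow has the form `larrow e.obj m hm`.
  obtain rfl : m.cod = f := w
  exact (actOn_eq A _ e.obj rfl m hm rfl).symm

/-- The canonical maps `A_e ⟶ L_x` as a morphism of `G`-modules. -/
noncomputable def toColimIdt (A : GModule G) : A ⟶ lcatToQuot G ⋙ (colimIdt G).obj A where
  app e := toColimClass A e.obj (QuotBeta.mk e.obj) rfl
  naturality _ _ g := map_toColimClass_eq_act A g

/-- Restrictions become identities in G/β, up to transport between equal classes. Hence a morphism
from A to a restricted G/β-module is compatible with the transition maps defining L_x. -/
lemma lcatToQuot_map_lres {e f : G} (h : Mor.id f ≤ Mor.id e) :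
    (lcatToQuot G).map (lres e f h) = eqToHom (QuotBeta.mk_eq_mk.2 (Beta.of_le h).symm) := by
  -- The target is generalised so that the equality of classes can be eliminated; the classes of `e`
  -- and `f` are equal only propositionally.
  have key : ∀ {x : QuotBeta G} (hx : QuotBeta.mk e = x),
      QuotMor.mk (Mor.id e) = (show QuotHom (QuotBeta.mk e) x from eqToHom hx).q := by
    rintro _ rfl
    rfl
  exact QuotHom.ext ((QuotMor.mk_eq_mk.2 (Beta.of_le h)).trans (key _))

/-! ### The adjunction between `colimIdt` and restriction -/

/-- The map `L_x ⟶ N_x` induced by a morphism from a `G`-module to a `G/β`-module. -/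
noncomputable def colimClassDesc {A : GModule G} {N : QuotBeta G ⥤ AddCommGrpCat.{u}}
    (φ : A ⟶ lcatToQuot G ⋙ N) (x : QuotBeta G) : colimClass A x ⟶ N.obj x :=
  colimit.desc (classDiagram A x)
    { pt := N.obj x
      ι :=
        -- `φ` takes values in N at the class of e, which equals x only propositionally; the
        -- `eqToHom` moves them to the fixed target N_x.
        { app := fun e => φ.app ⟨e.unop.1.obj⟩ ≫ N.map (eqToHom (by exact e.unop.2))
          naturality := fun e f i => by
            have h := φ.naturality (lres e.unop.1.obj f.unop.1.obj (leOfHom i.unop))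
            rw [Functor.comp_map, lcatToQuot_map_lres] at h
            refine Eq.trans ?_ (Category.comp_id _).symm
            refine (Category.assoc _ _ _).symm.trans ((congrArg (· ≫ _) h).trans ?_)
            exact (Category.assoc _ _ _).trans (congrArg (φ.app _ ≫ ·)
              ((N.map_comp _ _).symm.trans (congrArg N.map (eqToHom_trans _ _)))) } }

/-- At the class of `e` itself the transport is an identity. Both inverse laws of the adjunction
reduce to this formula, since maps out of L_x are determined on the A_e. -/
lemma toColimClass_desc {A : GModule G} {N : QuotBeta G ⥤ AddCommGrpCat.{u}}
    (φ : A ⟶ lcatToQuot G ⋙ N) (e : LCat G) :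
    toColimClass A e.obj _ rfl ≫ colimClassDesc φ (QuotBeta.mk e.obj) = φ.app e := by
  refine (colimit.ι_desc (F := classDiagram A (QuotBeta.mk e.obj)) _ (op ⟨⟨e.obj⟩, rfl⟩)).trans ?_
  exact (congrArg (φ.app e ≫ ·) (N.map_id _)).trans (Category.comp_id _)

/-- Naturality over G/β is inherited from naturality over 𝔏(G): after precomposition with A_e, the
arrow `q` may be replaced by an arrow of 𝔏(G) out of `e` lying over it. -/
lemma act_colimClassDesc {A : GModule G} {N : QuotBeta G ⥤ AddCommGrpCat.{u}}
    (φ : A ⟶ lcatToQuot G ⋙ N) {x y : QuotBeta G} (q : x ⟶ y) :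
    act A q ≫ colimClassDesc φ y = colimClassDesc φ x ≫ N.map q := by
  refine colimClass_hom_ext A fun e he => ?_
  obtain ⟨m, hm, hq⟩ := q.q.exists_rep e (q.dom_eq.trans he.symm)
  have hy := q.mk_cod hq
  -- With x and y replaced by the classes of `e` and `m.cod`, the arrow `q` is exactly the image of
  -- `larrow e m hm`, with no transport.
  subst he hy
  obtain rfl : toQuotHom (larrow e m hm) = q := QuotHom.ext hq
  have h : toColimClass A e _ rfl ≫ act A (toQuotHom (larrow e m hm)) ≫ colimClassDesc φ _
      = A.map (larrow e m hm) ≫ φ.app ⟨m.cod⟩ :=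
    (Category.assoc _ _ _).symm.trans ((congrArg (· ≫ colimClassDesc φ _)
      (map_toColimClass_eq_act A (larrow e m hm)).symm).trans ((Category.assoc _ _ _).trans
        (congrArg (A.map (larrow e m hm) ≫ ·) (toColimClass_desc φ ⟨m.cod⟩))))
  exact h.trans ((φ.naturality (larrow e m hm)).trans
    ((congrArg (· ≫ N.map (toQuotHom (larrow e m hm))) (toColimClass_desc φ ⟨e⟩).symm).trans
      (Category.assoc _ _ _)))

variable (G) in
/-- `colim^{E(G)}` is left adjoint to restriction along `𝔏(G) ⥤ G/β`. -/
noncomputable def colimIdtAdjunction :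
    colimIdt G ⊣ (Functor.whiskeringLeft _ _ AddCommGrpCat.{u}).obj (lcatToQuot G) :=
  Adjunction.mkOfHomEquiv
    { homEquiv := fun A N =>
        { toFun := fun ψ => toColimIdt A ≫ Functor.whiskerLeft (lcatToQuot G) ψ
          invFun := fun φ =>
            { app := fun x => colimClassDesc φ x
              naturality := fun x y q => act_colimClassDesc φ q }
          left_inv := fun ψ => by
            refine NatTrans.ext (funext fun x => colimClass_hom_ext A fun e he => ?_)
            subst he
            exact toColimClass_desc (toColimIdt A ≫ Functor.whiskerLeft (lcatToQuot G) ψ) ⟨e⟩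
          right_inv := fun φ => NatTrans.ext (funext fun e => toColimClass_desc φ e) }
      homEquiv_naturality_left_symm := fun {A B N} f φ => by
        refine NatTrans.ext (funext fun x => colimClass_hom_ext A fun e he => ?_)
        subst he
        refine (toColimClass_desc (f ≫ φ) ⟨e⟩).trans ?_
        refine Eq.trans ?_ (Category.assoc _ _ _)
        refine Eq.trans ?_ (congrArg (· ≫ colimClassDesc φ _) (toColimClass_map f e _ rfl)).symm
        refine Eq.trans ?_ (Category.assoc _ _ _).symm
        exact congrArg (f.app ⟨e⟩ ≫ ·) (toColimClass_desc φ ⟨e⟩).symm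
      homEquiv_naturality_right := fun f g => rfl }

/-! ### Exactness of `colimIdt` and preservation of projectives -/

instance : (colimIdt G).Additive := (colimIdtAdjunction G).left_adjoint_additive

/-- Epimorphisms of modules are detected objectwise, so the right adjoint, restriction, preserves
them. -/
instance : (colimIdt G).PreservesProjectiveObjects where
  projective_obj hP := (colimIdtAdjunction G).map_projective _ hP

/-- Finite limits of G/β-modules are computed objectwise, and the value at x is restriction to the
class followed by a filtered colimit, which is exact on abelian groups. -/
instance : PreservesFiniteLimits (colimIdt G) := by
  refine preservesFiniteLimits_of_evaluation _ fun x => ?_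
  change PreservesFiniteLimits ((Functor.whiskeringLeft _ _ AddCommGrpCat.{u}).obj
    ((Subtype.mono_coe (fun e : Idt G => QuotBeta.mk e.obj = x)).functor.op ⋙ idtToLCat G) ⋙ colim)
  infer_instance

instance : PreservesFiniteColimits (colimIdt G) := by
  have := (colimIdtAdjunction G).leftAdjoint_preservesColimits
  infer_instance

/-- The colimit of a `G`-module is the colimit over `G/β` of its colimit over the `β`-classes. -/
noncomputable def colimIsoColimIdtComp :
    (colim : GModule G ⥤ AddCommGrpCat.{u}) ≅ colimIdt G ⋙ colim :=
  -- Both functors are left adjoint to the constant-module functor: restricting a constant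
  -- G/β-module to 𝔏(G) gives, by definition, the constant G-module.
  colimConstAdj.leftAdjointUniq ((colimIdtAdjunction G).comp colimConstAdj)

end OrderedGroupoid

theorem mainTheorem1 (G : Type u) [OrderedGroupoid G] [OrderedGroupoid.PrincipallyDirected G]
    (A : OrderedGroupoid.GModule G) (n : ℕ) :
    Nonempty ((OrderedGroupoid.homology G n).obj A ≅
      (categoryHomology (OrderedGroupoid.QuotBeta G) n).obj
        ((OrderedGroupoid.colimIdt G).obj A)) :=
  ⟨(OrderedGroupoid.colimIdt G).leftDerivedCompObjIso colim colim
    OrderedGroupoid.colimIsoColimIdtComp n A⟩
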